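/- For $f:[l]\to[N]$ let the evaluation $\mathrm{ev}(f)$ be the sequence of length $N$ whose $j$-th entry is $|f^{-1}(j)|$. A function $g:[n]\to[n]$ is a parking function if, when cars $1,\dots,n$ enter one by one a one-way street with spots $1,\dots,n$ and car $i$ parks in the first free spot among $g(i),g(i)+1,\dots,n$, all cars can park. For $m\ge 1$, an $m$-multiparking function of size $mn$ is a function $f:[mn]\to[n]$ such that $\mathrm{ev}(f)=m\,\mathrm{ev}(g)$ for some parking function $g:[n]\to[n]$; we identify it with the word $f(1)f(2)\cdots f(mn)$. The hyposylvester congruence is the equivalence relation on words over a totally ordered alphabet generated by $$\cdots ac\cdots b\cdots\;\equiv\;\cdots ca\cdots b\cdots\quad(a\le b<c),\qquad \cdots b\cdots ac\cdots\;\equiv\;\cdots b\cdots ca\cdots\quad(a<b<c),$$ where in each relation only the two displayed adjacent letters $a,c$ are exchanged and all other letters of the word are unchanged. Theorem. For all integers $m\ge 1$ and $n\ge 1$, the number of hyposylvester classes of $m$-multiparking functions of size $mn$ is $$\frac1n\sum_{k=0}^{n-1}\binom nk\binom{3n-k}{2n+1}(m-1)^k,$$ where $(m-1)^0=1$ also for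 $m=1$. -/

import Mathlib

namespace HypoPark

/-- `p` records a successful run of the parking procedure for the preferences `f`: car `i` parks
in spot `p i`, no spot is used twice, and `p i` is the first spot from `f i` on that is not
already taken by an earlier car. -/
def IsParkingOutcome {n : ℕ} (f p : Fin n → Fin n) : Prop :=
  Function.Injective p ∧
    ∀ i, f i ≤ p i ∧ ∀ s, f i ≤ s → s < p i → ∃ j, j < i ∧ p j = s

/-- Parking functions of size `n` (with `[n]` modelled by `Fin n`): all cars can park. -/
def IsParkingFunction {n : ℕ} (f : Fin n → Fin n) : Prop :=
  ∃ p : Fin n → Fin n, IsParkingOutcome f p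

/-- The evaluation of `f`: the `j`-th entry is the number of `i` with `f i = j`. -/
def evaluation {l N : ℕ} (f : Fin l → Fin N) (j : Fin N) : ℕ :=
  (Finset.univ.filter fun i => f i = j).card

/-- `m`-multiparking functions of size `m * n`. -/
def IsMultiparkingFunction (m : ℕ) {n : ℕ} (f : Fin (m * n) → Fin n) : Prop :=
  ∃ g : Fin n → Fin n, IsParkingFunction g ∧ ∀ j, evaluation f j = m * evaluation g j

/-- The elementary rewritings generating the hyposylvester congruence on words:
`⋯ac⋯b⋯ ≡ ⋯ca⋯b⋯` for `a ≤ b < c`, and `⋯b⋯ac⋯ ≡ ⋯b⋯ca⋯` for `a < b < c`. -/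
inductive HyposylvesterStep {α : Type*} [LinearOrder α] : List α → List α → Prop
  | right (u v w : List α) (a b c : α) (hab : a ≤ b) (hbc : b < c) :
      HyposylvesterStep (u ++ [a, c] ++ v ++ [b] ++ w) (u ++ [c, a] ++ v ++ [b] ++ w)
  | left (u v w : List α) (a b c : α) (hab : a < b) (hbc : b < c) :
      HyposylvesterStep (u ++ [b] ++ v ++ [a, c] ++ w) (u ++ [b] ++ v ++ [c, a] ++ w)

/-- The hyposylvester congruence on words: the equivalence relation generated by the
elementary rewritings. -/
def hyposylvester (α : Type*) [LinearOrder α] : Setoid (List α) :=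
  Relation.EqvGen.setoid HyposylvesterStep

/-- Two `m`-multiparking functions are hyposylvester congruent when their words
`f(1)f(2)⋯f(mn)` are. -/
def multiparkingSetoid (m n : ℕ) :
    Setoid {f : Fin (m * n) → Fin n // IsMultiparkingFunction m f} :=
  (hyposylvester (Fin n)).comap fun f => List.ofFn f.1

/-- The set of hyposylvester classes of `m`-multiparking functions of size `m * n`. -/
def HyposylvesterClass (m n : ℕ) : Type :=
  Quotient (multiparkingSetoid m n)

end HypoPark

/-! A hyposylvester class is determined by the evaluation of its words and, for each pair of
consecutive letters `a < c` of the support, the number of letters `c` after the last `a`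
(`hyposylvester_iff`). The moves preserve these numbers. Conversely, when they agree, the first
letter of one word can be moved to the front of the other, and induction applies.

A multiparking function uses its smallest letter, so every other letter `c` of its support has a
predecessor there. The invariant of `c` takes each value from `0` to `m * e c` independently
(`countAfterLast_canonicalWord`), where `m * e` is the evaluation. The classes are therefore counted
by the sum over parking evaluations `e` of the product of `m * e j + 1` over `j ≠ 0`; absent letters
contribute `1` (`card_hyposylvesterClass_eq_card_codes`, `card_codes`).

This sum is evaluated by a weighted cycle lemma (`succ_mul_sum_dominatingSequences`). Splitting off
the entry `e 0`, which carries weight `1`, shows that `n` times the count is the coefficient of `x ^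
n` in `(∑ k x ^ k) (∑ (m k + 1) x ^ k) ^ n = x (1 + (m - 1) x) ^ n / (1 - x) ^ (2 n + 2)`, and the
binomial theorem finishes. -/

namespace HypoPark

/-! ### Invariants of the hyposylvester congruence. -/

section Words

variable {α : Type*} [LinearOrder α]

/-- The number of letters `c` after the last letter `a` of a word (all the letters `c` if `a` does
not occur). -/
def countAfterLast (a c : α) : List α → ℕ
  | [] => 0
  | x :: w => if a ∈ w then countAfterLast a c w else (x :: w).count c

theorem countAfterLast_of_notMem {a c : α} {w : List α} (h : a ∉ w) :
    countAfterLast a c w = w.count c := by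
  cases w with
  | nil => rfl
  | cons x w => simp only [countAfterLast, if_neg fun h' => h (List.mem_cons_of_mem _ h')]

theorem countAfterLast_cons_of_mem {a c x : α} {w : List α} (h : a ∈ w) :
    countAfterLast a c (x :: w) = countAfterLast a c w := by
  simp only [countAfterLast, if_pos h]

theorem countAfterLast_cons_of_notMem {a c x : α} {w : List α} (h : a ∉ w) :
    countAfterLast a c (x :: w) = (x :: w).count c := by
  simp only [countAfterLast, if_neg h]

theorem countAfterLast_le_count (a c : α) (w : List α) : countAfterLast a c w ≤ w.count c := by
  induction w with
  | nil => simp [countAfterLast]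
  | cons x w ih =>
    by_cases h : a ∈ w
    · rw [countAfterLast_cons_of_mem h]
      exact ih.trans (List.count_le_count_cons ..)
    · rw [countAfterLast_cons_of_notMem h]

theorem countAfterLast_append_cons {a c : α} (hac : a ≠ c) (p : List α) {q : List α}
    (hq : a ∉ q) : countAfterLast a c (p ++ a :: q) = q.count c := by
  induction p with
  | nil =>
    rw [List.nil_append, countAfterLast_cons_of_notMem hq, List.count_cons_of_ne hac]
  | cons x p ih => rw [List.cons_append, countAfterLast_cons_of_mem (by simp), ih]

theorem countAfterLast_append {a c : α} {p q : List α} (hp : a ∈ p) (hq : a ∉ q) :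
    countAfterLast a c (p ++ q) = countAfterLast a c p + q.count c := by
  induction p with
  | nil => simp at hp
  | cons x p ih =>
    by_cases h : a ∈ p
    · rw [List.cons_append, countAfterLast_cons_of_mem h,
        countAfterLast_cons_of_mem (List.mem_append_left _ h), ih h]
    · rw [List.cons_append, countAfterLast_cons_of_notMem h,
        countAfterLast_cons_of_notMem (by simp [h, hq]), ← List.cons_append, List.count_append]

theorem countAfterLast_append_of_mem {a c : α} (p : List α) {q : List α} (hq : a ∈ q) :
    countAfterLast a c (p ++ q) = countAfterLast a c q := by
  induction p with
  | nil => rfl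
  | cons x p ih => rw [List.cons_append, countAfterLast_cons_of_mem (by simp [hq]), ih]

/-- Exchange of two adjacent letters `a < c` when some letter of `s` lies strictly between them or
`a` occurs again further right. -/
inductive SwapStep (s : Set α) : List α → List α → Prop
  | swap (a c : α) (z : List α) (_ : a < c) (h : (∃ b ∈ s, a < b ∧ b < c) ∨ a ∈ z) :
      SwapStep s (a :: c :: z) (c :: a :: z)
  | cons (x : α) {y z : List α} (h : SwapStep s y z) : SwapStep s (x :: y) (x :: z)

theorem SwapStep.append_left {s : Set α} {y z : List α} (h : SwapStep s y z) (u : List α) :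
    SwapStep s (u ++ y) (u ++ z) := by
  induction u with
  | nil => exact h
  | cons x u ih => exact ih.cons x

theorem SwapStep.perm {s : Set α} {y z : List α} (h : SwapStep s y z) : y.Perm z := by
  induction h with
  | swap a c z => exact List.Perm.swap ..
  | cons x _ ih => exact ih.cons x

/-- Only exchanging the last `a` with a `c` could change the number. Such an exchange needs a letter
of `s` between them, excluded by `hs`, or a further `a` to the right. -/
theorem SwapStep.countAfterLast_eq {s : Set α} {y z : List α} (h : SwapStep s y z) {a c : α}
    (hac : a < c) (hs : ∀ b ∈ s, a < b → ¬ b < c) :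
    countAfterLast a c y = countAfterLast a c z := by
  induction h with
  | swap a' c' z hac' h =>
    by_cases hz : a ∈ z
    · simp [countAfterLast, hz]
    · by_cases h1 : a = a'
      · subst h1
        have h2 : c ≠ c' := by
          rintro rfl
          rcases h with ⟨b, hb, h1, h2⟩ | h
          · exact hs b hb h1 h2
          · exact hz h
        simp [countAfterLast, hz, hac'.ne, hac.ne, h2.symm]
      · by_cases h2 : a = c'
        · subst h2
          simp [countAfterLast, hz, hac'.ne', hac.ne, (hac'.trans hac).ne]
        · simp [countAfterLast, hz, h1, h2, List.count_cons]
          omega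
  | @cons x y z h ih =>
    by_cases hy : a ∈ y
    · rw [countAfterLast_cons_of_mem hy, countAfterLast_cons_of_mem (h.perm.mem_iff.1 hy), ih]
    · rw [countAfterLast_cons_of_notMem hy,
        countAfterLast_cons_of_notMem (fun h' => hy (h.perm.mem_iff.2 h'))]
      exact (h.perm.cons x).count_eq c

theorem eqvGen_swapStep_perm {s : Set α} {y z : List α} (h : Relation.EqvGen (SwapStep s) y z) :
    y.Perm z := by
  induction h with
  | rel _ _ h => exact h.perm
  | refl _ => exact List.Perm.refl _
  | symm _ _ _ ih => exact ih.symm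
  | trans _ _ _ _ _ ih₁ ih₂ => exact ih₁.trans ih₂

theorem eqvGen_swapStep_countAfterLast_eq {s : Set α} {y z : List α}
    (h : Relation.EqvGen (SwapStep s) y z) {a c : α} (hac : a < c)
    (hs : ∀ b ∈ s, a < b → ¬ b < c) : countAfterLast a c y = countAfterLast a c z := by
  induction h with
  | rel _ _ h => exact h.countAfterLast_eq hac hs
  | refl _ => rfl
  | symm _ _ _ ih => exact ih.symm
  | trans _ _ _ _ _ ih₁ ih₂ => exact ih₁.trans ih₂

theorem eqvGen_swapStep_cons {s : Set α} {y z : List α} (x : α)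
    (h : Relation.EqvGen (SwapStep s) y z) : Relation.EqvGen (SwapStep s) (x :: y) (x :: z) := by
  induction h with
  | rel _ _ h => exact .rel _ _ (h.cons x)
  | refl _ => exact .refl _
  | symm _ _ _ ih => exact ih.symm
  | trans _ _ _ _ _ ih₁ ih₂ => exact ih₁.trans _ _ _ ih₂

theorem eqvGen_swapStep_move_front {s : Set α} (x : α) (p q : List α)
    (h : ∀ p₁ y p₂, p = p₁ ++ y :: p₂ → Relation.EqvGen (SwapStep s)
      (y :: x :: (p₂ ++ q)) (x :: y :: (p₂ ++ q))) :
    Relation.EqvGen (SwapStep s) (p ++ x :: q) (x :: (p ++ q)) := by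
  induction p with
  | nil => exact .refl _
  | cons y p ih =>
    refine .trans _ _ _ (eqvGen_swapStep_cons y (ih fun p₁ y' p₂ hp => h (y :: p₁) y' p₂ ?_))
      (h [] y p rfl)
    rw [hp, List.cons_append]

/-- Words with the same evaluation and the same invariants are related by exchanges. -/
theorem eqvGen_swapStep_of_countAfterLast_eq {s : Set α} {w w' : List α} (hp : w.Perm w')
    (h : ∀ a c, a < c → (∀ b ∈ s, a < b → ¬ b < c) →
      countAfterLast a c w = countAfterLast a c w') :
    Relation.EqvGen (SwapStep s) w w' := by
  induction w generalizing w' with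
  | nil => rw [List.nil_perm.1 hp]; exact .refl _
  | cons x w ih =>
    obtain ⟨p, q, rfl, hxp⟩ := List.eq_append_cons_of_mem (hp.mem_iff.1 List.mem_cons_self)
    have hmove : Relation.EqvGen (SwapStep s) (p ++ x :: q) (x :: (p ++ q)) := by
      refine eqvGen_swapStep_move_front x p q fun p₁ y p₂ hpe => ?_
      have hyp : y ∈ p := by rw [hpe]; simp
      have hyx : y ≠ x := fun h => hxp (h ▸ hyp)
      have hyw : y ∈ w := by
        have := hp.mem_iff.2 (List.mem_append_left _ hyp)
        simpa [hyx] using this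
      rcases lt_or_gt_of_ne hyx with hlt | hgt
      · refine .rel _ _ (.swap y x _ hlt ?_)
        -- If the exchange is forbidden, this `y` is the last one in `p ++ x :: q`, and every `x`
        -- there lies after it. In `x :: w` the leading `x` precedes a `y`, so fewer are counted.
        by_contra! hcon
        have heq := h y x hlt fun b hb h1 => not_lt.2 (hcon.1 b hb h1)
        have hc := hp.count_eq x
        rw [countAfterLast_cons_of_mem hyw, hpe, List.append_assoc, List.cons_append,
          countAfterLast_append_cons hyx] at heq
        · have h3 := countAfterLast_le_count y x w
          have h4 : p.count x = 0 := List.count_eq_zero.2 hxp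
          have h5 : p₂.count x = 0 := List.count_eq_zero.2 fun h => hxp (by simp [hpe, h])
          simp only [List.count_append, List.count_cons_self] at hc heq
          omega
        · have := hcon.2
          simp only [List.mem_append, List.mem_cons, not_or] at this ⊢
          exact ⟨this.1, hyx, this.2⟩
      · refine .symm _ _ (.rel _ _ (.swap x y _ hgt ?_))
        -- If the exchange is forbidden, `x` occurs only once. In `x :: w` every `y` follows it,
        -- whereas in `p ++ x :: q` at least one `y` precedes it.
        by_contra! hcon
        have hxq : x ∉ q := fun h => hcon.2 (List.mem_append_right _ h)
        have heq := h x y hgt fun b hb h1 => not_lt.2 (hcon.1 b hb h1)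
        have hxw : x ∉ w := by
          have hc := hp.count_eq x
          rw [List.count_cons_self, List.count_append, List.count_cons_self,
            List.count_eq_zero.2 hxp, List.count_eq_zero.2 hxq] at hc
          exact List.count_eq_zero.1 (by omega)
        rw [countAfterLast_cons_of_notMem hxw, countAfterLast_append_cons hyx.symm p hxq,
          hp.count_eq y, List.count_append, List.count_cons_of_ne hyx.symm] at heq
        have := List.count_pos_iff.2 hyp
        omega
    refine .trans _ _ _ (eqvGen_swapStep_cons x (ih ?_ fun a c hac hs => ?_)) hmove.symm
    · exact (List.perm_cons x).1 (hp.trans (eqvGen_swapStep_perm hmove))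
    · have hpw : w.Perm (p ++ q) := (List.perm_cons x).1 (hp.trans (eqvGen_swapStep_perm hmove))
      by_cases ha : a ∈ w
      · have := (h a c hac hs).trans (eqvGen_swapStep_countAfterLast_eq hmove hac hs)
        rwa [countAfterLast_cons_of_mem ha,
          countAfterLast_cons_of_mem (hpw.mem_iff.1 ha)] at this
      · rw [countAfterLast_of_notMem ha, hpw.count_eq c,
          countAfterLast_of_notMem fun h' => ha (hpw.mem_iff.2 h')]

theorem HyposylvesterStep.swapStep {w w' : List α} (h : HyposylvesterStep w w') :
    SwapStep {x | x ∈ w} w w' := by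
  cases h with
  | right u v x a b c hab hbc =>
    simp only [List.append_assoc, List.cons_append, List.nil_append]
    refine SwapStep.append_left (.swap a c _ (hab.trans_lt hbc) ?_) u
    rcases hab.eq_or_lt with rfl | hab
    · right; simp
    · exact Or.inl ⟨b, by simp, hab, hbc⟩
  | left u v x a b c hab hbc =>
    simp only [List.append_assoc, List.cons_append, List.nil_append]
    have := SwapStep.append_left (.swap a c x (hab.trans hbc)
      (Or.inl ⟨b, by simp, hab, hbc⟩) :
        SwapStep {y | y ∈ u ++ b :: (v ++ a :: c :: x)} _ _) (u ++ b :: v)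
    simpa using this

/-- The prefix `u` accumulates the letters passed by `SwapStep.cons`, so that an intermediate letter
of `s` can be located to the left or to the right of the exchanged pair. -/
theorem hyposylvesterStep_of_swapStep {s : Set α} {y z : List α} (h : SwapStep s y z)
    (u : List α) (hs : ∀ x ∈ s, x ∈ u ++ y) : HyposylvesterStep (u ++ y) (u ++ z) := by
  induction h generalizing u with
  | swap a c z hac h =>
    have key : (∃ b ∈ u ++ a :: c :: z, a < b ∧ b < c) ∨ a ∈ z :=
      h.imp_left fun ⟨b, hb, h⟩ => ⟨b, hs b hb, h⟩
    have hright : ∀ b ∈ z, a ≤ b → b < c →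
        HyposylvesterStep (u ++ a :: c :: z) (u ++ c :: a :: z) := by
      intro b hb h1 h2
      obtain ⟨v, w, rfl⟩ := List.append_of_mem hb
      simpa using HyposylvesterStep.right u v w a b c h1 h2
    rcases key with ⟨b, hb, h1, h2⟩ | h
    · simp only [List.mem_append, List.mem_cons, h1.ne', h2.ne, false_or] at hb
      rcases hb with hb | hb
      · obtain ⟨v, w, rfl⟩ := List.append_of_mem hb
        simpa using HyposylvesterStep.left v w z a b c h1 h2
      · exact hright b hb h1.le h2
    · exact hright a h le_rfl hac
  | @cons x y z _ ih => simpa using ih (u ++ [x]) (by simpa using hs)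

/-- Exchanges preserve the support, so one fixed set `s` serves along a whole chain of rewritings.
-/
theorem eqvGen_swapStep_of_hyposylvester {w w' : List α} (h : hyposylvester α w w') :
    Relation.EqvGen (SwapStep {x | x ∈ w}) w w' := by
  have key : ∀ w w' : List α, Relation.EqvGen HyposylvesterStep w w' →
      Relation.EqvGen (SwapStep {x | x ∈ w}) w w' := by
    intro w w' h
    induction h with
    | rel _ _ h => exact .rel _ _ h.swapStep
    | refl _ => exact .refl _
    | symm x y _ ih =>
      have : {a | a ∈ y} = {a | a ∈ x} := Set.ext fun a => (eqvGen_swapStep_perm ih).mem_iff.symm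
      rw [this]
      exact ih.symm
    | trans x y _ _ _ ih₁ ih₂ =>
      have : {a | a ∈ y} = {a | a ∈ x} := Set.ext fun a => (eqvGen_swapStep_perm ih₁).mem_iff.symm
      rw [this] at ih₂
      exact ih₁.trans _ _ _ ih₂
  exact key w w' h

theorem hyposylvester_of_eqvGen_swapStep {s : Set α} {w w' : List α}
    (h : Relation.EqvGen (SwapStep s) w w') (hs : ∀ x ∈ s, x ∈ w) : hyposylvester α w w' := by
  have key : Relation.EqvGen HyposylvesterStep w w' := by
    induction h with
    | rel _ _ h => exact .rel _ _ (hyposylvesterStep_of_swapStep h [] hs)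
    | refl _ => exact .refl _
    | symm x y hxy ih =>
      exact (ih fun a ha => (eqvGen_swapStep_perm hxy).mem_iff.2 (hs a ha)).symm
    | trans x y _ hxy _ ih₁ ih₂ =>
      exact (ih₁ hs).trans _ _ _ (ih₂ fun a ha => (eqvGen_swapStep_perm hxy).mem_iff.1 (hs a ha))
  exact key

/-- Two words are hyposylvester congruent if and only if they have the same evaluation and, for
any two consecutive letters `a < c` of their support, the same number of letters `c` after the last
letter `a`. -/
theorem hyposylvester_iff {w w' : List α} :
    hyposylvester α w w' ↔ w.Perm w' ∧ ∀ a ∈ w, ∀ c, a < c → (∀ b ∈ w, a < b → ¬ b < c) →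
      countAfterLast a c w = countAfterLast a c w' := by
  constructor
  · intro h
    have h' := eqvGen_swapStep_of_hyposylvester h
    exact ⟨eqvGen_swapStep_perm h', fun a _ c hac hs =>
      eqvGen_swapStep_countAfterLast_eq h' hac hs⟩
  · rintro ⟨hp, h⟩
    refine hyposylvester_of_eqvGen_swapStep (s := {x | x ∈ w})
      (eqvGen_swapStep_of_countAfterLast_eq hp fun a c hac hs => ?_) fun x hx => hx
    by_cases ha : a ∈ w
    · exact h a ha c hac hs
    · rw [countAfterLast_of_notMem ha, hp.count_eq c,
        countAfterLast_of_notMem fun h' => ha (hp.mem_iff.2 h')]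

end Words

/-! ### Words with prescribed invariants. -/

section CanonicalWord

theorem countAfterLast_of_pairwise_le {α : Type*} [LinearOrder α] {a c : α} (hac : a < c)
    {w : List α} (h : w.Pairwise (· ≤ ·)) : countAfterLast a c w = w.count c := by
  induction h with
  | nil => rfl
  | @cons x w hx _ ih =>
    by_cases ha : a ∈ w
    · rw [countAfterLast_cons_of_mem ha, ih, List.count_cons_of_ne ((hx a ha).trans_lt hac).ne]
    · rw [countAfterLast_cons_of_notMem ha]

theorem countAfterLast_of_pairwise_ge {α : Type*} [LinearOrder α] {a c : α} (hac : a < c)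
    {w : List α} (h : w.Pairwise (· ≥ ·)) (ha : a ∈ w) : countAfterLast a c w = 0 := by
  induction h with
  | nil => simp at ha
  | @cons x w hx _ ih =>
    by_cases haw : a ∈ w
    · rw [countAfterLast_cons_of_mem haw, ih haw]
    · obtain rfl : a = x := by simpa [haw] using ha
      rw [countAfterLast_cons_of_notMem haw, List.count_cons_of_ne hac.ne]
      exact List.count_eq_zero.2 fun hc => hac.not_ge (hx c hc)

variable {n : ℕ}

/-- The weakly increasing word with `t k` letters `k`. -/
def increasingWord (t : Fin n → ℕ) : List (Fin n) :=
  (List.finRange n).flatMap fun k => List.replicate (t k) k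

theorem count_increasingWord (t : Fin n → ℕ) (c : Fin n) : (increasingWord t).count c = t c := by
  rw [increasingWord, List.count_flatMap, ← List.ofFn_eq_map, Fin.sum_ofFn]
  simp [List.count_replicate]

theorem pairwise_increasingWord (t : Fin n → ℕ) : (increasingWord t).Pairwise (· ≤ ·) := by
  rw [increasingWord, List.pairwise_flatMap]
  refine ⟨fun k _ => by simp [List.pairwise_replicate], ?_⟩
  refine (List.pairwise_lt_finRange n).imp fun {a b} hab x hx y hy => ?_
  rw [List.eq_of_mem_replicate hx, List.eq_of_mem_replicate hy]
  exact hab.le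

/-- The word with `u k + t k` letters `k`, of which `t k` follow and `u k` precede all smaller
letters. -/
def canonicalWord (u t : Fin n → ℕ) : List (Fin n) :=
  (increasingWord u).reverse ++ increasingWord t

theorem count_canonicalWord (u t : Fin n → ℕ) (c : Fin n) :
    (canonicalWord u t).count c = u c + t c := by
  rw [canonicalWord, List.count_append, List.count_reverse, count_increasingWord,
    count_increasingWord]

/-- In the increasing half every `c` follows every `a`; in the decreasing half every `c` precedes
every `a`. So the `t c` copies in the increasing half are counted, whichever half contains the last
`a`. -/
theorem countAfterLast_canonicalWord (u t : Fin n → ℕ) {a c : Fin n} (hac : a < c)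
    (ha : a ∈ canonicalWord u t) : countAfterLast a c (canonicalWord u t) = t c := by
  by_cases h : a ∈ increasingWord t
  · rw [canonicalWord, countAfterLast_append_of_mem _ h,
      countAfterLast_of_pairwise_le hac (pairwise_increasingWord t), count_increasingWord]
  · have ha' : a ∈ (increasingWord u).reverse := by
      simpa [canonicalWord, h] using ha
    rw [canonicalWord, countAfterLast_append ha' h,
      countAfterLast_of_pairwise_ge hac (List.pairwise_reverse.2 (pairwise_increasingWord u)) ha',
      count_increasingWord, zero_add]

theorem length_eq_sum_count (w : List (Fin n)) : w.length = ∑ c, w.count c := by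
  simpa using (Multiset.sum_count_eq_card (s := Finset.univ) (m := (w : Multiset (Fin n)))
    fun a _ => Finset.mem_univ a).symm

theorem exists_ofFn_eq {α : Type*} {l : ℕ} (w : List α) (h : w.length = l) :
    ∃ f : Fin l → α, List.ofFn f = w := by
  subst h
  exact ⟨w.get, List.ofFn_get w⟩

theorem evaluation_eq_count {l : ℕ} (f : Fin l → Fin n) (j : Fin n) :
    evaluation f j = (List.ofFn f).count j := by
  rw [← Multiset.coe_count, ← Fin.univ_val_map, Multiset.count_map, evaluation, Finset.card_def,
    Finset.filter_val]
  simp only [eq_comm]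

theorem sum_evaluation {l : ℕ} (f : Fin l → Fin n) : ∑ j, evaluation f j = l := by
  simp only [evaluation_eq_count]
  rw [← length_eq_sum_count, List.length_ofFn]

end CanonicalWord

/-! ### Evaluations of parking functions. -/

section ParkingEvaluations

/-- The sequences `e` of length `N` with sum `N + 1 - r` such that `r` plus the sum of the first
`j` entries exceeds `j` for all `j ≤ N`. -/
def dominatingSequences (N r : ℕ) : Finset (Fin N → ℕ) :=
  (Finset.Nat.antidiagonalTuple N (N + 1 - r)).filter fun e =>
    r + ∑ i, e i = N + 1 ∧ ∀ j : Fin N, (j : ℕ) + 1 ≤ r + ∑ i with i < j, e i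

/-- The sum condition is kept inside the filter because `N + 1 - r` truncates to `0` for large `r`.
-/
theorem mem_dominatingSequences {N r : ℕ} {e : Fin N → ℕ} :
    e ∈ dominatingSequences N r ↔
      r + ∑ i, e i = N + 1 ∧ ∀ j : Fin N, (j : ℕ) + 1 ≤ r + ∑ i with i < j, e i := by
  rw [dominatingSequences, Finset.mem_filter, Finset.Nat.mem_antidiagonalTuple]
  exact ⟨fun h => h.2, fun h => ⟨by omega, h⟩⟩

theorem sum_evaluation_lt {l n : ℕ} (f : Fin l → Fin n) (j : Fin n) :
    ∑ i with i < j, evaluation f i = (Finset.univ.filter fun k => f k < j).card := by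
  rw [Finset.card_eq_sum_card_fiberwise (f := f) (t := Finset.univ.filter (· < j))]
  · refine Finset.sum_congr rfl fun i hi => ?_
    rw [evaluation, Finset.filter_filter]
    congr 1
    ext k
    simp only [Finset.mem_filter, Finset.mem_univ, true_and] at hi ⊢
    exact ⟨fun h => ⟨h ▸ hi, h⟩, fun h => h.2⟩
  · intro k hk
    simpa using hk

/-- All spots get filled, and a car parked below `j` also prefers a spot below `j`. -/
theorem IsParkingFunction.evaluation_mem {n : ℕ} {g : Fin n → Fin n} (hg : IsParkingFunction g) :
    evaluation g ∈ dominatingSequences n 1 := by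
  obtain ⟨p, hp, h⟩ := hg
  rw [mem_dominatingSequences, sum_evaluation]
  refine ⟨add_comm _ _, fun j => ?_⟩
  rw [sum_evaluation_lt, add_comm]
  refine Nat.add_le_add_left ?_ 1
  have hb : Function.Bijective p := Finite.injective_iff_bijective.1 hp
  calc (j : ℕ) = (Finset.univ.filter fun k => k < j).card := by
        rw [show (Finset.univ.filter fun k => k < j) = Finset.Iio j by ext; simp, Fin.card_Iio]
    _ = (Finset.univ.filter fun k => p k < j).card := by
        refine (Finset.card_bijective p hb fun k => ?_).symm
        simp
    _ ≤ _ := Finset.card_le_card fun k hk => by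
        simp only [Finset.mem_filter, Finset.mem_univ, true_and] at hk ⊢
        exact (h k).1.trans_lt hk

theorem isParkingFunction_of_le {n : ℕ} {g : Fin n → Fin n} (h : ∀ i, g i ≤ i) :
    IsParkingFunction g :=
  ⟨id, Function.injective_id, fun i => ⟨h i, fun s _ hs => ⟨s, hs, rfl⟩⟩⟩

/-- For the increasing arrangement, domination says `g i ≤ i`, so car `i` parks in spot `i`. -/
theorem exists_isParkingFunction_evaluation_eq {n : ℕ} {e : Fin n → ℕ}
    (he : e ∈ dominatingSequences n 1) :
    ∃ g : Fin n → Fin n, IsParkingFunction g ∧ evaluation g = e := by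
  rw [mem_dominatingSequences] at he
  obtain ⟨g, hg⟩ := exists_ofFn_eq (l := n) (increasingWord e) (by
    rw [length_eq_sum_count]
    simp only [count_increasingWord]
    omega)
  have hev : evaluation g = e := funext fun j => by
    rw [evaluation_eq_count, hg, count_increasingWord]
  have hmono : Monotone g := by
    intro i j hij
    have := pairwise_increasingWord e
    rw [← hg, List.pairwise_ofFn] at this
    rcases hij.eq_or_lt with rfl | hij
    · rfl
    · exact this hij
  refine ⟨g, isParkingFunction_of_le fun i => ?_, hev⟩
  by_contra! hlt
  have h1 := he.2 (g i)
  rw [← hev, sum_evaluation_lt] at h1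
  have h2 : (Finset.univ.filter fun k => g k < g i).card ≤ (Finset.Iio i).card :=
    Finset.card_le_card fun k hk => by
      simp only [Finset.mem_filter, Finset.mem_univ, true_and, Finset.mem_Iio] at hk ⊢
      exact hmono.reflect_lt hk
  rw [Fin.card_Iio] at h2
  have h3 : (i : ℕ) < g i := hlt
  omega

theorem isMultiparkingFunction_iff {m n : ℕ} {f : Fin (m * n) → Fin n} :
    IsMultiparkingFunction m f ↔
      ∃ e ∈ dominatingSequences n 1, ∀ j, evaluation f j = m * e j := by
  constructor
  · rintro ⟨g, hg, h⟩
    exact ⟨_, hg.evaluation_mem, h⟩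
  · rintro ⟨e, he, h⟩
    obtain ⟨g, hg, rfl⟩ := exists_isParkingFunction_evaluation_eq he
    exact ⟨g, hg, h⟩

end ParkingEvaluations

/-! ### Classes encoded by an evaluation and invariants. -/

section Codes

/-- The pairs `(e, t)` of a parking evaluation `e` and a sequence `t` with `t 0 = 0` and
`t j ≤ m * e j` for `j ≠ 0`. -/
def codes (m N : ℕ) : Finset (Σ _ : Fin (N + 1) → ℕ, Fin (N + 1) → ℕ) :=
  (dominatingSequences (N + 1) 1).sigma fun e =>
    Fintype.piFinset fun j => Finset.range (if j = 0 then 1 else m * e j + 1)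

theorem mem_codes {m N : ℕ} {x : Σ _ : Fin (N + 1) → ℕ, Fin (N + 1) → ℕ} :
    x ∈ codes m N ↔ x.1 ∈ dominatingSequences (N + 1) 1 ∧ x.2 0 = 0 ∧
      ∀ j, x.2 j ≤ m * x.1 j := by
  rw [codes, Finset.mem_sigma, Fintype.mem_piFinset]
  refine and_congr_right fun _ => ⟨fun h => ?_, fun h j => ?_⟩
  · have h0 : x.2 0 = 0 := by simpa using h 0
    refine ⟨h0, fun j => ?_⟩
    have := h j
    split_ifs at this with hj
    · rw [hj, h0]; exact Nat.zero_le _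
    · exact Nat.lt_succ_iff.1 (Finset.mem_range.1 this)
  · split_ifs with hj
    · rw [hj, h.1]; simp
    · exact Finset.mem_range.2 (Nat.lt_succ_iff.2 (h.2 j))

/-- The word with evaluation `m * e` and invariants `t`. -/
def codeWord (m : ℕ) {N : ℕ} (x : Σ _ : Fin (N + 1) → ℕ, Fin (N + 1) → ℕ) :
    List (Fin (N + 1)) :=
  canonicalWord (fun j => m * x.1 j - x.2 j) x.2

variable {m N : ℕ} {x : Σ _ : Fin (N + 1) → ℕ, Fin (N + 1) → ℕ}

theorem count_codeWord (hx : x ∈ codes m N) (c : Fin (N + 1)) :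
    (codeWord m x).count c = m * x.1 c := by
  rw [codeWord, count_canonicalWord]
  exact Nat.sub_add_cancel ((mem_codes.1 hx).2.2 c)

theorem length_codeWord (hx : x ∈ codes m N) : (codeWord m x).length = m * (N + 1) := by
  rw [length_eq_sum_count]
  simp only [count_codeWord hx]
  rw [← Finset.mul_sum]
  have := (mem_dominatingSequences.1 (mem_codes.1 hx).1).1
  rw [show ∑ i, x.1 i = N + 1 by omega]

theorem one_le_of_mem_dominatingSequences {e : Fin (N + 1) → ℕ}
    (he : e ∈ dominatingSequences (N + 1) 1) : 1 ≤ e 0 := by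
  rw [mem_dominatingSequences] at he
  -- The inequality at `j = 1` gives the bound, but for `N = 0` there is no such index and the total
  -- sum is used instead.
  rcases N with _ | N
  · have := he.1
    simp only [Fin.sum_univ_succ, Finset.univ_eq_empty, Finset.sum_empty] at this
    omega
  · have h := he.2 1
    have : (Finset.univ.filter fun i : Fin (N + 1 + 1) => i < 1) = {0} := by
      ext i
      simp [Fin.lt_one_iff]
    rw [this, Finset.sum_singleton, Fin.val_one] at h
    omega

theorem exists_consecutive {w : List (Fin (N + 1))} (h0 : 0 ∈ w) {c : Fin (N + 1)} (hc : c ≠ 0) :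
    ∃ a ∈ w, a < c ∧ ∀ b ∈ w, a < b → ¬ b < c := by
  have hne : (w.toFinset.filter (· < c)).Nonempty :=
    ⟨0, by simp [h0, Fin.pos_iff_ne_zero, hc]⟩
  have hmem := Finset.max'_mem _ hne
  have hmax := Finset.le_max' (w.toFinset.filter (· < c))
  simp only [Finset.mem_filter, List.mem_toFinset] at hmem
  exact ⟨_, hmem.1, hmem.2, fun b hb h1 h2 => (hmax b (by simpa using ⟨hb, h2⟩)).not_gt h1⟩

theorem zero_mem_codeWord (hm : 1 ≤ m) (hx : x ∈ codes m N) : 0 ∈ codeWord m x := by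
  rw [← List.count_pos_iff, count_codeWord hx]
  exact Nat.mul_pos hm (one_le_of_mem_dominatingSequences (mem_codes.1 hx).1)

theorem eq_of_hyposylvester_codeWord (hm : 1 ≤ m)
    {y : Σ _ : Fin (N + 1) → ℕ, Fin (N + 1) → ℕ} (hx : x ∈ codes m N) (hy : y ∈ codes m N)
    (h : hyposylvester _ (codeWord m x) (codeWord m y)) : x = y := by
  obtain ⟨hp, hT⟩ := hyposylvester_iff.1 h
  have h1 : x.1 = y.1 := funext fun j => by
    have := hp.count_eq j
    rw [count_codeWord hx, count_codeWord hy] at this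
    exact Nat.eq_of_mul_eq_mul_left hm this
  have h2 : x.2 = y.2 := funext fun c => by
    by_cases hc : c = 0
    · rw [hc, (mem_codes.1 hx).2.1, (mem_codes.1 hy).2.1]
    · obtain ⟨a, ha, hac, hb⟩ := exists_consecutive (zero_mem_codeWord hm hx) hc
      have := hT a ha c hac hb
      rwa [codeWord, codeWord, countAfterLast_canonicalWord _ _ hac ha,
        countAfterLast_canonicalWord _ _ hac (hp.mem_iff.1 ha)] at this
  exact Sigma.ext h1 (heq_of_eq h2)

theorem exists_code_hyposylvester (hm : 1 ≤ m) {e : Fin (N + 1) → ℕ}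
    (he : e ∈ dominatingSequences (N + 1) 1) {w : List (Fin (N + 1))}
    (hw : ∀ j, w.count j = m * e j) : ∃ x ∈ codes m N, hyposylvester _ (codeWord m x) w := by
  have h0 : 0 ∈ w := by
    rw [← List.count_pos_iff, hw]
    exact Nat.mul_pos hm (one_le_of_mem_dominatingSequences he)
  choose! a haw hac hb using fun c hc => exists_consecutive h0 (c := c) hc
  let x : Σ _ : Fin (N + 1) → ℕ, Fin (N + 1) → ℕ :=
    ⟨e, fun c => if c = 0 then 0 else countAfterLast (a c) c w⟩
  have hx : x ∈ codes m N := by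
    refine mem_codes.2 ⟨he, by simp [x], fun j => ?_⟩
    change (if j = 0 then 0 else countAfterLast (a j) j w) ≤ m * e j
    split_ifs
    · exact Nat.zero_le _
    · exact (countAfterLast_le_count _ _ _).trans (hw j).le
  have hp : (codeWord m x).Perm w := List.perm_iff_count.2 fun c => by
    rw [count_codeWord hx, hw]
  refine ⟨x, hx, hyposylvester_iff.2 ⟨hp, fun b hbx c hbc hs => ?_⟩⟩
  have hc : c ≠ 0 := (Fin.pos_iff_ne_zero).1 ((Fin.zero_le b).trans_lt hbc)
  have hab : b = a c := by
    refine le_antisymm (not_lt.1 fun h => hb c hc b (hp.mem_iff.1 hbx) h hbc)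
      (not_lt.1 fun h => hs (a c) (hp.mem_iff.2 (haw c hc)) h (hac c hc))
  subst hab
  rw [codeWord, countAfterLast_canonicalWord _ _ hbc hbx]
  exact if_neg hc

theorem card_hyposylvesterClass_eq_card_codes (hm : 1 ≤ m) :
    Nat.card (HyposylvesterClass m (N + 1)) = (codes m N).card := by
  have hex : ∀ x : codes m N, ∃ f : {f : Fin (m * (N + 1)) → Fin (N + 1) //
      IsMultiparkingFunction m f}, List.ofFn f.1 = codeWord m x.1 := by
    rintro ⟨x, hx⟩
    obtain ⟨f, hf⟩ := exists_ofFn_eq _ (length_codeWord hx)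
    refine ⟨⟨f, isMultiparkingFunction_iff.2 ⟨x.1, (mem_codes.1 hx).1, fun j => ?_⟩⟩, hf⟩
    rw [evaluation_eq_count, hf, count_codeWord hx]
  choose F hF using hex
  rw [← Fintype.card_coe, ← Nat.card_eq_fintype_card]
  refine (Nat.card_congr (Equiv.ofBijective
    (fun x => (Quotient.mk (multiparkingSetoid m (N + 1)) (F x) :
      HyposylvesterClass m (N + 1))) ⟨fun x y hxy => ?_, fun q => ?_⟩)).symm
  · have h : hyposylvester _ (List.ofFn (F x).1) (List.ofFn (F y).1) :=
      Quotient.exact (s := multiparkingSetoid m (N + 1)) hxy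
    rw [hF, hF] at h
    exact Subtype.ext (eq_of_hyposylvester_codeWord hm x.2 y.2 h)
  · obtain ⟨f, rfl⟩ := Quotient.exists_rep q
    obtain ⟨e, he, hf⟩ := isMultiparkingFunction_iff.1 f.2
    obtain ⟨x, hx, h⟩ := exists_code_hyposylvester hm he (w := List.ofFn f.1) fun j => by
      rw [← evaluation_eq_count, hf]
    rw [← hF ⟨x, hx⟩] at h
    exact ⟨⟨x, hx⟩, Quotient.sound h⟩

theorem card_codes (m N : ℕ) :
    (codes m N).card = ∑ e ∈ dominatingSequences (N + 1) 1, ∏ j : Fin N, (m * e j.succ + 1) := by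
  rw [codes, Finset.card_sigma]
  refine Finset.sum_congr rfl fun e _ => ?_
  rw [Fintype.card_piFinset, Fin.prod_univ_succ]
  simp [Fin.succ_ne_zero]

end Codes

/-! ### Weighted cycle lemma and coefficient extraction. -/

section Enumeration

open PowerSeries

/-- Removing the first entry shifts all indices by one, which costs `1`, and adds `k` to the initial
height. The inequality at index `0` holds because `r + 1` is positive. -/
theorem cons_mem_dominatingSequences {N r k : ℕ} {e : Fin N → ℕ} :
    (Fin.cons k e : Fin (N + 1) → ℕ) ∈ dominatingSequences (N + 1) (r + 1) ↔
      e ∈ dominatingSequences N (r + k) := by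
  simp only [mem_dominatingSequences, Finset.sum_filter, Fin.forall_fin_succ, Fin.sum_univ_succ,
    Fin.cons_zero, Fin.cons_succ, Fin.val_zero, Fin.val_succ, Fin.succ_lt_succ_iff, lt_irrefl,
    if_false, Fin.succ_pos, if_true, Fin.not_lt_zero, Finset.sum_const_zero]
  refine and_congr (by omega) ⟨fun h j => ?_, fun h => ⟨by omega, fun j => ?_⟩⟩
  · have := h.2 j
    omega
  · have := h j
    omega

theorem sum_dominatingSequences_succ {M : Type*} [AddCommMonoid M] (N r : ℕ)
    (f : (Fin (N + 1) → ℕ) → M) :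
    ∑ e ∈ dominatingSequences (N + 1) (r + 1), f e =
      ∑ k ∈ Finset.range (N + 2), ∑ e ∈ dominatingSequences N (r + k), f (Fin.cons k e) := by
  rw [Finset.sum_sigma']
  refine Finset.sum_bij' (fun e _ => ⟨e 0, Fin.tail e⟩) (fun x _ => Fin.cons x.1 x.2)
    (fun e he => ?_) (fun x hx => ?_) (fun e _ => Fin.cons_self_tail e) (fun x _ => ?_)
    (fun e _ => by rw [Fin.cons_self_tail])
  · rw [← Fin.cons_self_tail e, cons_mem_dominatingSequences] at he
    rw [Finset.mem_sigma, Finset.mem_range]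
    refine ⟨?_, he⟩
    have := (mem_dominatingSequences.1 he).1
    change e 0 < N + 2
    omega
  · rw [Finset.mem_sigma] at hx
    exact cons_mem_dominatingSequences.2 hx.2
  · simp

theorem dominatingSequences_zero_right (N : ℕ) : dominatingSequences N 0 = ∅ := by
  refine Finset.eq_empty_of_forall_notMem fun e he => ?_
  rw [mem_dominatingSequences] at he
  rcases N with _ | N
  · simp at he
  · have := he.2 0
    simp at this

theorem sum_mul_coeff_X_pow_mul {R : Type*} [CommSemiring R] (a : ℕ → R) (M : ℕ)
    (Y : PowerSeries R) :
    ∑ k ∈ Finset.range (M + 1), a k * coeff M (X ^ k * Y) = coeff M (mk a * Y) := by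
  rw [coeff_mul, Finset.Nat.sum_antidiagonal_eq_sum_range_succ_mk]
  refine Finset.sum_congr rfl fun k hk => ?_
  rw [coeff_mk, coeff_X_pow_mul', if_pos (Nat.lt_succ_iff.1 (Finset.mem_range.1 hk))]

/-- The total weight of the dominating sequences, as in the cycle lemma. -/
theorem succ_mul_sum_dominatingSequences (w : ℕ → ℚ) (hw : w 0 = 1) (N r : ℕ) :
    ((N : ℚ) + 1) * ∑ e ∈ dominatingSequences N r, ∏ j, w (e j) =
      r * coeff (N + 1) (X ^ r * mk w ^ (N + 1)) := by
  induction N generalizing r with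
  | zero =>
    rcases r with _ | _ | r
    · simp [dominatingSequences_zero_right]
    -- The empty sequence has weight `1` while the coefficient is `w 0`; this is where `hw` enters.
    · have : dominatingSequences 0 1 = Finset.univ := by
        ext e
        simp only [mem_dominatingSequences, Finset.mem_univ, iff_true]
        simp
      simp [this, hw]
    · have : dominatingSequences 0 (r + 1 + 1) = ∅ := by
        ext e
        simp [mem_dominatingSequences]
      simp [this, coeff_X_pow_mul']
  | succ N ih =>
    rcases r with _ | r
    · simp [dominatingSequences_zero_right]
    set G : PowerSeries ℚ := mk w with hG
    -- Conditioning on the first entry `k` turns the induction hypothesis, with its factor `r + k`,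
    -- into a convolution.
    have hrec : ((N : ℚ) + 1) * ∑ e ∈ dominatingSequences (N + 1) (r + 1), ∏ j, w (e j) =
        coeff (N + 1) (mk (fun k => ((r : ℚ) + k) * w k) * (X ^ r * G ^ (N + 1))) := by
      rw [sum_dominatingSequences_succ, Finset.mul_sum, ← sum_mul_coeff_X_pow_mul]
      refine Finset.sum_congr rfl fun k _ => ?_
      simp only [Fin.prod_univ_succ, Fin.cons_zero, Fin.cons_succ]
      rw [← Finset.mul_sum, mul_left_comm, ih, pow_add]
      push_cast
      rw [mul_comm (X ^ r : PowerSeries ℚ), mul_assoc]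
      ring
    have hH : mk (fun k => ((r : ℚ) + k) * w k) = (r : PowerSeries ℚ) * G + X * derivative ℚ G := by
      ext k
      have hr : coeff k ((r : PowerSeries ℚ) * G) = r * w k := by
        rw [← map_natCast (C (R := ℚ)), coeff_C_mul, hG, coeff_mk]
      rw [map_add, hr, coeff_mk]
      rcases k with _ | k
      · simp
      · rw [coeff_succ_X_mul, coeff_derivative, hG, coeff_mk]
        push_cast
        ring
    have hD : X * derivative ℚ (X ^ r * G ^ (N + 2)) =
        (r : PowerSeries ℚ) * (X ^ r * G ^ (N + 2)) +
          ((N + 2 : ℕ) : PowerSeries ℚ) * (X ^ r * (X * derivative ℚ G) * G ^ (N + 1)) := by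
      rw [Derivation.leibniz, Derivation.leibniz_pow, Derivation.leibniz_pow]
      simp only [smul_eq_mul, nsmul_eq_mul, derivative_X, show N + 2 - 1 = N + 1 from rfl]
      rcases r with _ | r
      · simp
        ring
      · rw [show r + 1 - 1 = r from rfl]
        push_cast
        ring
    -- The operator `X * d/dX` multiplies the coefficient of degree `N + 1` by `N + 1`. Comparison
    -- with `hD` eliminates the term containing the derivative of `G` from `hrec`.
    have hE : coeff (N + 1) (X * derivative ℚ (X ^ r * G ^ (N + 2))) =
        ((N : ℚ) + 1) * coeff (N + 1) (X ^ r * G ^ (N + 2)) := by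
      rw [coeff_succ_X_mul, coeff_derivative, mul_comm]
    have hcast : ∀ (a : ℕ) (Y : PowerSeries ℚ), coeff (N + 1) ((a : PowerSeries ℚ) * Y) =
        a * coeff (N + 1) Y := fun a Y => by
      rw [← map_natCast (C (R := ℚ)), coeff_C_mul]
    rw [hD, map_add, hcast, hcast] at hE
    have hrec' : mk (fun k => ((r : ℚ) + k) * w k) * (X ^ r * G ^ (N + 1)) =
        (r : PowerSeries ℚ) * (X ^ r * G ^ (N + 2)) +
          X ^ r * (X * derivative ℚ G) * G ^ (N + 1) := by
      rw [hH]; ring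
    rw [hrec', map_add, hcast] at hrec
    have hgoal : coeff (N + 1 + 1) (X ^ (r + 1) * G ^ (N + 1 + 1)) =
        coeff (N + 1) (X ^ r * G ^ (N + 2)) := by
      rw [pow_succ' X r, mul_assoc, coeff_succ_X_mul]
    rw [hgoal]
    have hN : ((N : ℚ) + 1) ≠ 0 := by positivity
    apply mul_left_cancel₀ hN
    push_cast at hE ⊢
    linear_combination ((N : ℚ) + 2) * hrec + hE

theorem mk_mul_add_one (m : ℚ) :
    (mk fun k => m * k + 1 : PowerSeries ℚ) = (1 + C (m - 1) * X) * mk 1 ^ 2 := by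
  rw [mk_one_pow_eq_mk_choose_add ℚ 1, add_mul, one_mul, mul_assoc]
  ext k
  rw [map_add, coeff_C_mul]
  rcases k with _ | k
  · simp
  · rw [coeff_succ_X_mul]
    simp only [coeff_mk, Nat.choose_one_right]
    push_cast
    ring

theorem mk_natCast_eq : (mk fun k => (k : ℚ)) = X * mk 1 ^ 2 := by
  rw [mk_one_pow_eq_mk_choose_add ℚ 1]
  ext k
  rcases k with _ | k
  · simp
  · rw [coeff_succ_X_mul]
    simp only [coeff_mk, Nat.choose_one_right]
    push_cast
    ring

theorem succ_mul_card_codes (m N : ℕ) :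
    ((N : ℚ) + 1) * ((codes m N).card : ℚ) = ∑ k ∈ Finset.range (N + 1),
      ((N + 1).choose k : ℚ) * ((3 * (N + 1) - k).choose (2 * (N + 1) + 1) : ℚ) *
        ((m : ℚ) - 1) ^ k := by
  have h1 : ((N : ℚ) + 1) * ((codes m N).card : ℚ) = coeff (N + 1)
      (mk (fun k => (k : ℚ)) * mk (fun k => (m : ℚ) * k + 1) ^ (N + 1)) := by
    rw [card_codes, sum_dominatingSequences_succ, Nat.cast_sum, Finset.mul_sum,
      ← sum_mul_coeff_X_pow_mul]
    refine Finset.sum_congr rfl fun k _ => ?_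
    rw [← succ_mul_sum_dominatingSequences _ (by simp)]
    simp
  have h2 : mk (fun k => (k : ℚ)) * mk (fun k => (m : ℚ) * k + 1) ^ (N + 1) =
      X * ∑ k ∈ Finset.range (N + 2), C (((N + 1).choose k : ℚ) * ((m : ℚ) - 1) ^ k) *
        (X ^ k * mk 1 ^ (2 * N + 3 + 1)) := by
    have hbin : (1 + C ((m : ℚ) - 1) * X : PowerSeries ℚ) ^ (N + 1) =
        ∑ k ∈ Finset.range (N + 2), C (((N + 1).choose k : ℚ) * ((m : ℚ) - 1) ^ k) * X ^ k := by
      rw [add_comm, add_pow]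
      refine Finset.sum_congr rfl fun k _ => ?_
      rw [map_mul, map_pow, map_natCast, mul_pow, one_pow]
      ring
    simp only [← mul_assoc (C _)]
    rw [← Finset.sum_mul, ← hbin, mk_natCast_eq, mk_mul_add_one, mul_pow]
    ring
  -- After the factor `X` is removed, the coefficient of degree `N` is wanted, so the binomial term
  -- `k = N + 1` vanishes.
  rw [h1, h2, coeff_succ_X_mul, map_sum, Finset.sum_range_succ]
  simp only [coeff_C_mul]
  rw [coeff_X_pow_mul', if_neg (by omega), mul_zero, add_zero]
  refine Finset.sum_congr rfl fun k hk => ?_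
  have hk : k ≤ N := Nat.lt_succ_iff.1 (Finset.mem_range.1 hk)
  rw [coeff_X_pow_mul', if_pos hk, mk_one_pow_eq_mk_choose_add, coeff_mk,
    show 2 * N + 3 + (N - k) = 3 * (N + 1) - k by omega,
    show 2 * N + 3 = 2 * (N + 1) + 1 by ring]
  ring

end Enumeration

end HypoPark

theorem mainTheorem9 (m n : ℕ) (hm : 1 ≤ m) (hn : 1 ≤ n) :
    (Nat.card (HypoPark.HyposylvesterClass m n) : ℚ) =
      1 / (n : ℚ) * ∑ k ∈ Finset.range n,
        (Nat.choose n k : ℚ) * (Nat.choose (3 * n - k) (2 * n + 1) : ℚ) * ((m : ℚ) - 1) ^ k := by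
  obtain ⟨N, rfl⟩ := Nat.exists_eq_add_of_le' hn
  have hN : ((N : ℚ) + 1) ≠ 0 := by positivity
  rw [HypoPark.card_hyposylvesterClass_eq_card_codes hm, ← HypoPark.succ_mul_card_codes]
  push_cast
  field_simp
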